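/- Let $S_{g,b}$ denote the compact connected orientable surface of genus $g$ with $b\ge 0$ boundary components, with a fixed orientation. Directed graphs may have loops and parallel edges. An embedding of a directed graph $G$ in $S_{g,b}$ is an embedding in the interior of the surface as a subcomplex of the 1-skeleton of some finite cell structure (on the closed surface obtained by filling the boundary components with disks, which are placed inside the open 2-cells). The embedding need not be cellular: the faces, i.e. the connected components of the complement of $G$, need not be disks. It is also required that no loop is the boundary of a disk and that no two edges with the same endpoints together are the boundary of a disk. Write $\mathrm{left}(e)$ and $\mathrm{right}(e)$ for the (possibly equal) faces to the left and right of a directed edge $e$. An Alexander numbering is a function $\alpha$ from the faces to $\mathbb Z$ that vanishes on each face that meets the boundary of the surface. A closed walk with at least one edge, which follows the directions of the edges, is bounding if for some Alexander numbering $\alpha$ it traverses each edge $e$ exactly $\alpha(\mathrm{left}(e))-\alpha(\mathrm{right}(e))$ times; equivalently, its integer homology class is trivial. The length of a walk is its number of edges, counted with multiplicity. Theorem. For every integer $g\ge 2$ there is a constant $c>0$ such that for all integers $b\ge 0$ and $n\ge 1$ there is a directed graph with exactly $2n$ vertices and $3n+1$ edges, embedded in $S_{g,b}$, that has a bounding closed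 walk and in which the shortest bounding closed walk has length at least $c\,n^2$. -/

import Mathlib

/-- A directed graph with vertex type `V` and edge type `E`; loops, parallel edges and
antiparallel edges are allowed. -/
structure DirectedMultigraph (V E : Type*) where
  /-- the vertex that an edge leaves -/
  tail : E → V
  /-- the vertex that an edge enters -/
  head : E → V

namespace DirectedMultigraph

variable {V E : Type*}

/-- `G.IsWalk u w v`: the list `w` of edges is the edge sequence of a directed walk from `u`
to `v`. Its length is `w.length`. -/
def IsWalk (G : DirectedMultigraph V E) : V → List E → V → Prop
  | u, [], v => u = v
  | u, e :: w, v => G.tail e = u ∧ G.IsWalk (G.head e) w v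

/-- A closed walk, as an edge sequence. We require at least one edge: a walk that stays at one
vertex is not counted. -/
def IsClosedWalk (G : DirectedMultigraph V E) (w : List E) : Prop :=
  w ≠ [] ∧ ∃ v, G.IsWalk v w v

end DirectedMultigraph

/-- A compact connected oriented surface, with or without boundary, glued from finitely many
polygons. `D` is the set of darts, i.e. the edges of the cell structure with a direction.
The closed surface is given by its rotation system, and `holes c` disjoint open disks
are then removed from the interior of each 2-cell `c`. -/
structure CellSurface (D : Type*) where
  /-- the next dart, counterclockwise, among those that leave the same vertex -/
  rot : Equiv.Perm D
  /-- reversal of a dart -/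
  rev : Equiv.Perm D
  rev_rev : ∀ d, rev (rev d) = d
  rev_ne : ∀ d, rev d ≠ d
  nonempty : Nonempty D
  /-- the surface is connected -/
  connected : MulAction.IsPretransitive (Subgroup.closure {rot, rev}) D
  /-- How many open disks are removed from each 2-cell. The 2-cells are the orbits of the
  permutation that takes a dart `d` to the next dart along the polygon on the left of `d`. -/
  holes : Quotient (Equiv.Perm.SameCycle.setoid (rot⁻¹ * rev)) → ℕ

namespace CellSurface

variable {D : Type*} (S : CellSurface D)

/-- The dart that follows a given dart on the boundary of the 2-cell to its left: reverse the
dart, then take the next one in clockwise order. -/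
def next : Equiv.Perm D := S.rot⁻¹ * S.rev

/-- 0-cells -/
def Vertex : Type _ := Quotient (Equiv.Perm.SameCycle.setoid S.rot)

/-- 1-cells -/
def Edge : Type _ := Quotient (Equiv.Perm.SameCycle.setoid S.rev)

/-- 2-cells -/
def Cell : Type _ := Quotient (Equiv.Perm.SameCycle.setoid S.next)

/-- The vertex that a dart leaves. -/
def vertexOf (d : D) : S.Vertex := Quotient.mk (Equiv.Perm.SameCycle.setoid S.rot) d

/-- The undirected edge of a dart. -/
def edgeOf (d : D) : S.Edge := Quotient.mk (Equiv.Perm.SameCycle.setoid S.rev) d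

/-- The 2-cell on the left of a dart. The 2-cell on the right of `d` is
`S.leftCell (S.rev d)`. -/
def leftCell (d : D) : S.Cell := Quotient.mk (Equiv.Perm.SameCycle.setoid S.next) d

/-- The number of removed open disks in a 2-cell. -/
def cellHoles (c : S.Cell) : ℕ := S.holes c

/-- The surface has genus `g`: the closed surface, before disks are removed, has Euler
characteristic `2 - 2g`. -/
def HasGenus (g : ℕ) : Prop :=
  (Nat.card S.Vertex : ℤ) - Nat.card S.Edge + Nat.card S.Cell = 2 - 2 * g

/-- The number of boundary components of the surface. -/
noncomputable def boundaryComponents : ℕ := ∑ᶠ c : S.Cell, S.cellHoles c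

/-- The edges with the region `R`, a set of 2-cells, on exactly one side. -/
def frontierEdges (R : Set S.Cell) : Set S.Edge :=
  {x | (∃ d, S.edgeOf d = x ∧ S.leftCell d ∈ R) ∧ ∃ d, S.edgeOf d = x ∧ S.leftCell d ∉ R}

/-- The edges with the region `R` on both sides. -/
def interiorEdges (R : Set S.Cell) : Set S.Edge :=
  {x | ∀ d, S.edgeOf d = x → S.leftCell d ∈ R}

/-- The vertices that are surrounded by the region `R`. -/
def interiorVertices (R : Set S.Cell) : Set S.Vertex :=
  {v | ∀ d, S.vertexOf d = v → S.leftCell d ∈ R}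

/-- The set `X` of edges (in use: one loop, or two edges with the same endpoints) is the
boundary of a disk in the surface: some region without holes has exactly `X` as its frontier,
and its interior has the Euler characteristic `1` of an open disk. -/
def BoundsDisk (X : Set S.Edge) : Prop :=
  ∃ R : Set S.Cell, S.frontierEdges R = X ∧ (∀ c ∈ R, S.cellHoles c = 0) ∧
    (R.ncard : ℤ) - (S.interiorEdges R).ncard + (S.interiorVertices R).ncard = 1

end CellSurface

/-- An embedding, not necessarily cellular, of the directed graph `G` on the surface `S`: the
graph is a subcomplex of the 1-skeleton of the cell structure. The 1-skeleton may have other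
vertices and edges, which serve only to cut the faces of `G` into polygons. -/
structure SurfaceEmbedding {V E D : Type*} (G : DirectedMultigraph V E) (S : CellSurface D) where
  /-- the point at which a vertex is placed -/
  vertex : V → S.Vertex
  vertex_injective : Function.Injective vertex
  /-- the dart along which an edge runs, from its tail to its head -/
  dart : E → D
  edge_injective : Function.Injective fun e => S.edgeOf (dart e)
  vertexOf_dart : ∀ e, S.vertexOf (dart e) = vertex (G.tail e)
  vertexOf_rev_dart : ∀ e, S.vertexOf (S.rev (dart e)) = vertex (G.head e)

namespace SurfaceEmbedding

variable {V E D : Type*} {G : DirectedMultigraph V E} {S : CellSurface D}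
  (φ : SurfaceEmbedding G S)

/-- Two 2-cells are adjacent off the graph if they share an edge that is not in the image of
the graph. (The 2-cells around a vertex that is not in the image are joined by such edges.) -/
def AdjacentOff (c c' : S.Cell) : Prop :=
  ∃ d, (∀ e, S.edgeOf (φ.dart e) ≠ S.edgeOf d) ∧ S.leftCell d = c ∧ S.leftCell (S.rev d) = c'

/-- The faces of the embedding, i.e. the connected components of the complement of the graph.
`Quot` passes to the equivalence relation that adjacency generates. -/
def Face : Type _ := Quot φ.AdjacentOff

/-- The face that contains a 2-cell. -/
def faceOf (c : S.Cell) : φ.Face := Quot.mk _ c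

/-- The left shore of an edge. -/
def left (e : E) : φ.Face := φ.faceOf (S.leftCell (φ.dart e))

/-- The right shore of an edge. -/
def right (e : E) : φ.Face := φ.faceOf (S.leftCell (S.rev (φ.dart e)))

/-- A boundary face is a face that meets the boundary of the surface. -/
def IsBoundaryFace (f : φ.Face) : Prop :=
  ∃ c : S.Cell, φ.faceOf c = f ∧ S.cellHoles c ≠ 0

/-- An Alexander numbering: an integer for each face, which is `0` for boundary faces. -/
def IsAlexanderNumbering (α : φ.Face → ℤ) : Prop :=
  ∀ f, φ.IsBoundaryFace f → α f = 0

/-- The boundary `∂α` of an Alexander numbering. -/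
def boundary (α : φ.Face → ℤ) (e : E) : ℤ := α (φ.left e) - α (φ.right e)

/-- A closed walk is bounding if it is an Euler tour of the boundary `∂α` of some Alexander
numbering `α`, i.e. if it traverses each edge `e` exactly `∂α e` times. -/
def IsBounding [DecidableEq E] (w : List E) : Prop :=
  G.IsClosedWalk w ∧ ∃ α : φ.Face → ℤ, φ.IsAlexanderNumbering α ∧
    ∀ e, (w.count e : ℤ) = φ.boundary α e

/-- `l` is the length of a shortest bounding closed walk; in particular there is one. -/
def IsShortestBoundingLength [DecidableEq E] (l : ℕ) : Prop :=
  IsLeast {k | ∃ w : List E, φ.IsBounding w ∧ w.length = k} l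

/-- The usual convention on surface graphs: no loop is the boundary of a disk, and no two
edges with the same endpoints (in either direction) together are the boundary of a disk. -/
def NoTrivialEdges : Prop :=
  (∀ e, G.tail e = G.head e → ¬ S.BoundsDisk {S.edgeOf (φ.dart e)}) ∧
  ∀ e e', e ≠ e' →
    (G.tail e = G.tail e' ∧ G.head e = G.head e') ∨
      (G.tail e = G.head e' ∧ G.head e = G.tail e') →
    ¬ S.BoundsDisk {S.edgeOf (φ.dart e), S.edgeOf (φ.dart e')}

end SurfaceEmbedding

/-! Put n = m + 1. The 2-cells are numbered 0, …, m + 1 so that `up k` and `down k` both have k on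
the left and k + 1 on the right, while every edge of the long cycle and the loop have 0 on the left
and m + 1 on the right. All other edges of the cell structure have the same 2-cell on both sides, so
the faces are exactly the 2-cells.

For a boundary of face values A, the two edges of rung k are thus traversed A k - A (k + 1) times
each, and the loop and every long edge A 0 - A (m + 1) times, which is the sum over all rungs. A
nonempty bounding walk makes this sum positive, so it visits both ends of the ladder. Being
connected, it uses every rung, each drop is at least 1, and the sum is at least n. The n edges of
the long cycle alone then contribute n² (`sq_le_length_of_isBounding`). Drops equal to 1 are
realized by `tour`, so a bounding walk exists (`isBounding_tour`).

The same cyclic arrangement of 2-cells rules out trivial edges: no set of 2-cells, disk or not, has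
a forbidden set of edges as its frontier (`noTrivialEdges`). Orbits of the rotation system are
identified by numerical labels (`sameCycle_rot`, `sameCycle_next`), which also gives the genus. -/

/-! ### Edges of the graph and of the cell structure -/

/-- The edges of the graph: a ladder of `m + 1` two-edge cycles (`up k`, `down k`), a long cycle
of `m + 1` edges at its lower end, and a loop at its upper end. -/
inductive LadderEdge (m : ℕ) : Type
  | up (k : Fin (m + 1))
  | down (k : Fin (m + 1))
  | long (k : Fin (m + 1))
  | loop
  deriving DecidableEq

/-- The edges of the cell structure: the graph, two arcs from the lower to the upper end of the
ladder, and `h` pairs of loops at the lower end that make `h` additional handles. -/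
inductive SkeletonEdge (m h : ℕ) : Type
  | edge (e : LadderEdge m)
  | arcLow
  | arcHigh
  | meridian (i : Fin h)
  | longitude (i : Fin h)

namespace LadderEdge

variable {m : ℕ}

/-- The edges as a sum type. -/
def equivSum (m : ℕ) :
    LadderEdge m ≃ (Fin (m + 1) ⊕ Fin (m + 1)) ⊕ (Fin (m + 1) ⊕ Unit) where
  toFun
    | up k => .inl (.inl k)
    | down k => .inl (.inr k)
    | long k => .inr (.inl k)
    | loop => .inr (.inr ())
  invFun
    | .inl (.inl k) => up k
    | .inl (.inr k) => down k
    | .inr (.inl k) => long k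
    | .inr (.inr ()) => loop
  left_inv e := by cases e <;> rfl
  right_inv s := by rcases s with (_ | _) | (_ | _) <;> rfl

instance : Fintype (LadderEdge m) := Fintype.ofEquiv _ (equivSum m).symm

theorem card (m : ℕ) : Fintype.card (LadderEdge m) = 3 * (m + 1) + 1 := by
  rw [Fintype.card_congr (equivSum m)]
  simp
  ring

end LadderEdge

namespace SkeletonEdge

variable {m h : ℕ}

/-- The edges of the cell structure as a sum type. -/
def equivSum (m h : ℕ) :
    SkeletonEdge m h ≃ (LadderEdge m ⊕ Bool) ⊕ (Fin h ⊕ Fin h) where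
  toFun
    | edge e => .inl (.inl e)
    | arcLow => .inl (.inr false)
    | arcHigh => .inl (.inr true)
    | meridian i => .inr (.inl i)
    | longitude i => .inr (.inr i)
  invFun
    | .inl (.inl e) => edge e
    | .inl (.inr false) => arcLow
    | .inl (.inr true) => arcHigh
    | .inr (.inl i) => meridian i
    | .inr (.inr i) => longitude i
  left_inv e := by cases e <;> rfl
  right_inv s := by rcases s with (_ | _ | _) | (_ | _) <;> rfl

instance : Fintype (SkeletonEdge m h) := Fintype.ofEquiv _ (equivSum m h).symm

theorem card (m h : ℕ) : Fintype.card (SkeletonEdge m h) = 3 * (m + 1) + 3 + 2 * h := by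
  rw [Fintype.card_congr (equivSum m h)]
  simp [LadderEdge.card]
  ring

end SkeletonEdge

/-! ### The rotation system and the numbering of vertices and 2-cells -/

/-- The darts of the cell structure; `(x, true)` runs in the direction of the edge `x`. -/
abbrev LadderDart (m h : ℕ) : Type := SkeletonEdge m h × Bool

namespace LadderDart

open LadderEdge SkeletonEdge

variable {m h : ℕ}

/-- The next dart, counterclockwise, at the same vertex. -/
def rotFun : LadderDart m h → LadderDart m h
  | (edge (up k), true) =>
    if k.1 = 0 then (edge (long (Fin.last m)), false)
    else (edge (down ⟨k - 1, by omega⟩), true)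
  | (edge (up k), false) =>
    if hk : k.1 + 1 < m + 1 then (edge (down ⟨k + 1, hk⟩), false) else (arcHigh, false)
  | (edge (down k), true) => (edge (up k), false)
  | (edge (down k), false) => (edge (up k), true)
  | (edge (long k), true) =>
    if k.1 = 0 then (arcLow, true) else (edge (long ⟨k - 1, by omega⟩), false)
  | (edge (long k), false) =>
    if hk : k.1 + 1 < m + 1 then (edge (long ⟨k + 1, hk⟩), true) else (arcHigh, true)
  | (edge loop, true) => (arcLow, false)
  | (edge loop, false) => (edge (down (Fin.last m)), true)
  | (arcHigh, true) => (edge (long 0), true)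
  | (arcHigh, false) => (edge loop, true)
  | (arcLow, true) => if hh : 0 < h then (meridian ⟨0, hh⟩, true) else (edge (down 0), false)
  | (arcLow, false) => (edge loop, false)
  | (meridian i, true) => (longitude i, true)
  | (meridian i, false) => (longitude i, false)
  | (longitude i, true) => (meridian i, false)
  | (longitude i, false) =>
    if hi : i.1 + 1 < h then (meridian ⟨i + 1, hi⟩, true) else (edge (down 0), false)

/-- The next dart, clockwise, at the same vertex. -/
def rotInv : LadderDart m h → LadderDart m h
  | (edge (up k), true) => (edge (down k), false)
  | (edge (up k), false) => (edge (down k), true)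
  | (edge (down k), true) =>
    if hk : k.1 + 1 < m + 1 then (edge (up ⟨k + 1, hk⟩), true) else (edge loop, false)
  | (edge (down k), false) =>
    if k.1 = 0 then
      if hh : 0 < h then (longitude ⟨h - 1, by omega⟩, false) else (arcLow, true)
    else (edge (up ⟨k - 1, by omega⟩), false)
  | (edge (long k), true) =>
    if k.1 = 0 then (arcHigh, true) else (edge (long ⟨k - 1, by omega⟩), false)
  | (edge (long k), false) =>
    if hk : k.1 + 1 < m + 1 then (edge (long ⟨k + 1, hk⟩), true) else (edge (up 0), true)
  | (edge loop, true) => (arcHigh, false)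
  | (edge loop, false) => (arcLow, false)
  | (arcHigh, true) => (edge (long (Fin.last m)), false)
  | (arcHigh, false) => (edge (up (Fin.last m)), false)
  | (arcLow, true) => (edge (long 0), true)
  | (arcLow, false) => (edge loop, true)
  | (meridian i, true) =>
    if i.1 = 0 then (arcLow, true) else (longitude ⟨i - 1, by omega⟩, false)
  | (meridian i, false) => (longitude i, true)
  | (longitude i, true) => (meridian i, true)
  | (longitude i, false) => (meridian i, false)

theorem rotInv_rotFun (d : LadderDart m h) : rotInv (rotFun d) = d := by
  rcases d with ⟨(((k | k | k | _) | _ | _ | i | i)), (_ | _)⟩ <;> simp only [rotFun] <;>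
    (try split_ifs) <;> simp only [rotInv] <;> (try split_ifs) <;>
    grind

theorem rotFun_rotInv (d : LadderDart m h) : rotFun (rotInv d) = d := by
  rcases d with ⟨(((k | k | k | _) | _ | _ | i | i)), (_ | _)⟩ <;> simp only [rotInv] <;>
    (try split_ifs) <;> simp only [rotFun] <;> (try split_ifs) <;>
    grind

/-- The rotation system. -/
def rot (m h : ℕ) : Equiv.Perm (LadderDart m h) where
  toFun := rotFun
  invFun := rotInv
  left_inv := rotInv_rotFun
  right_inv := rotFun_rotInv

/-- Reversal of darts. -/
def rev (m h : ℕ) : Equiv.Perm (LadderDart m h) where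
  toFun d := (d.1, !d.2)
  invFun d := (d.1, !d.2)
  left_inv d := by simp
  right_inv d := by simp

/-- The number of the vertex that a dart leaves: `0, …, m + 1` along the ladder and
`m + 2, …, 2 m + 1` along the long cycle. -/
def vertexLabel : LadderDart m h → ℕ
  | (edge (up k), true) => k
  | (edge (up k), false) => k + 1
  | (edge (down k), true) => k + 1
  | (edge (down k), false) => k
  | (edge (long k), true) => if k.1 = 0 then 0 else m + 1 + k
  | (edge (long k), false) => if k.1 = m then 0 else m + 1 + (k + 1)
  | (edge loop, _) => m + 1
  | (arcHigh, true) => 0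
  | (arcHigh, false) => m + 1
  | (arcLow, true) => 0
  | (arcLow, false) => m + 1
  | (meridian _, _) => 0
  | (longitude _, _) => 0

/-- The number of the 2-cell to the left of a dart. -/
def cellLabel : LadderDart m h → ℕ
  | (edge (up k), true) => k
  | (edge (up k), false) => k + 1
  | (edge (down k), true) => k
  | (edge (down k), false) => k + 1
  | (edge (long _), true) => 0
  | (edge (long _), false) => m + 1
  | (edge loop, true) => 0
  | (edge loop, false) => m + 1
  | (arcHigh, _) => m + 1
  | (arcLow, _) => 0
  | (meridian _, _) => 0
  | (longitude _, _) => 0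

theorem vertexLabel_rot (d : LadderDart m h) : vertexLabel (rot m h d) = vertexLabel d := by
  change vertexLabel (rotFun d) = _
  rcases d with ⟨(((k | k | k | _) | _ | _ | i | i)), (_ | _)⟩ <;> simp only [rotFun] <;>
    (try split_ifs) <;> simp [vertexLabel] <;> grind

theorem cellLabel_next (d : LadderDart m h) :
    cellLabel (((rot m h)⁻¹ * rev m h) d) = cellLabel d := by
  change cellLabel (rotInv (d.1, !d.2)) = _
  rcases d with ⟨(((k | k | k | _) | _ | _ | i | i)), (_ | _)⟩ <;>
    simp only [rotInv, Bool.not_true, Bool.not_false] <;>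
    (try split_ifs) <;> simp [cellLabel] <;> grind

end LadderDart

/-! ### Orbits of a permutation as fibres of an invariant -/

namespace Equiv.Perm

variable {D : Type*} {σ : Equiv.Perm D}

theorem SameCycle.eq_of_invariant {T : Type*} {f : D → T} (hσ : ∀ d, f (σ d) = f d) {d d' : D}
    (h : σ.SameCycle d d') : f d = f d' := by
  obtain ⟨i, rfl⟩ := h
  induction i using Int.induction_on with
  | zero => simp
  | succ i ih => rw [add_comm, zpow_add, zpow_one, Equiv.Perm.mul_apply, hσ, ← ih]
  | pred i ih =>
    rw [ih, ← hσ ((σ ^ (-(i : ℤ) - 1)) d), ← Equiv.Perm.mul_apply, ← zpow_one_add]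
    congr 3
    ring

/-- The orbits of a permutation are the fibres of an invariant that separates representatives
of all orbits. -/
theorem sameCycle_iff_of_reps {T : Type*} {f : D → T} (hσ : ∀ d, f (σ d) = f d) {B : Set D}
    (hB : ∀ d, ∃ d₀ ∈ B, σ.SameCycle d d₀) (hinj : Set.InjOn f B) {d d' : D} :
    σ.SameCycle d d' ↔ f d = f d' := by
  refine ⟨SameCycle.eq_of_invariant hσ, fun h => ?_⟩
  obtain ⟨x, hx, hdx⟩ := hB d
  obtain ⟨y, hy, hdy⟩ := hB d'
  have hxy : x = y := hinj hx hy (by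
    rw [← hdx.eq_of_invariant hσ, h, hdy.eq_of_invariant hσ])
  subst hxy
  exact hdx.trans hdy.symm

theorem card_quotient_sameCycle {T : Type*} {f : D → T}
    (hf : ∀ d d', σ.SameCycle d d' ↔ f d = f d') :
    Nat.card (Quotient (Equiv.Perm.SameCycle.setoid σ)) = Nat.card (Set.range f) := by
  refine Nat.card_congr (Equiv.ofBijective (Quotient.lift (fun d => (⟨f d, d, rfl⟩ : Set.range f))
    fun d d' h => Subtype.ext ((hf d d').1 h)) ⟨?_, ?_⟩)
  · rintro ⟨d⟩ ⟨d'⟩ h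
    exact Quotient.sound ((hf d d').2 (congrArg Subtype.val h))
  · rintro ⟨_, d, rfl⟩
    exact ⟨Quotient.mk _ d, rfl⟩

end Equiv.Perm

/-! ### Orbits, connectedness and genus of the surface -/

namespace LadderDart

open LadderEdge SkeletonEdge

variable {m h : ℕ}

/-- One dart for each vertex. -/
def vertexReps (m h : ℕ) : Set (LadderDart m h) :=
  {d | (∃ k, d = (edge (up k), true)) ∨ d = (edge loop, true) ∨
    ∃ k : Fin (m + 1), k.1 ≠ 0 ∧ d = (edge (long k), true)}

/-- One dart for each 2-cell. -/
def cellReps (m h : ℕ) : Set (LadderDart m h) :=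
  {d | (∃ k, d = (edge (up k), true)) ∨ d = (arcHigh, true)}

/-- A predicate that is invariant under the rotation holds everywhere if it holds on
`vertexReps`. -/
theorem forall_of_vertexReps (P : LadderDart m h → Prop) (hf : ∀ d, P (rotFun d) → P d)
    (hi : ∀ d, P (rotInv d) → P d) (hB : ∀ d ∈ vertexReps m h, P d) (d) : P d := by
  have up' (k) : P (edge (up k), true) := hB _ (Or.inl ⟨k, rfl⟩)
  have loop' : P (edge loop, true) := hB _ (Or.inr (Or.inl rfl))
  have downF (k) : P (edge (down k), false) := hf _ (up' k)
  have arcLowF : P (arcLow, false) := hi _ loop'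
  have loopF : P (edge loop, false) := hi _ arcLowF
  have arcHighF : P (arcHigh, false) := hf _ loop'
  have downT (k) : P (edge (down k), true) := by
    apply hi
    simp only [rotInv]
    split_ifs
    exacts [up' _, loopF]
  have upF (k) : P (edge (up k), false) := hi _ (downT k)
  have longF (k) : P (edge (long k), false) := by
    apply hi
    simp only [rotInv]
    split_ifs
    exacts [hB _ (Or.inr (Or.inr ⟨⟨k + 1, by assumption⟩, by simp, rfl⟩)), up' _]
  have arcHighT : P (arcHigh, true) := hi _ (longF _)
  have longT (k) : P (edge (long k), true) := by
    apply hi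
    simp only [rotInv]
    split_ifs
    exacts [arcHighT, longF _]
  have arcLowT : P (arcLow, true) := hi _ (longT _)
  have handle (i : ℕ) (hh : i < h) :
      P (meridian ⟨i, hh⟩, true) ∧ P (longitude ⟨i, hh⟩, true) ∧
        P (meridian ⟨i, hh⟩, false) ∧ P (longitude ⟨i, hh⟩, false) := by
    induction i with
    | zero =>
      have h1 : P (meridian ⟨0, hh⟩, true) := hi _ arcLowT
      have h2 : P (longitude ⟨0, hh⟩, true) := hi _ h1
      have h3 : P (meridian ⟨0, hh⟩, false) := hi _ h2
      exact ⟨h1, h2, h3, hi _ h3⟩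
    | succ i ih =>
      have h1 : P (meridian ⟨i + 1, hh⟩, true) := hi _ (ih (by omega)).2.2.2
      have h2 : P (longitude ⟨i + 1, hh⟩, true) := hi _ h1
      have h3 : P (meridian ⟨i + 1, hh⟩, false) := hi _ h2
      exact ⟨h1, h2, h3, hi _ h3⟩
  rcases d with ⟨(((k | k | k | _) | _ | _ | i | i)), (_ | _)⟩
  exacts [upF k, up' k, downF k, downT k, longF k, longT k, loopF, loop', arcLowF, arcLowT,
    arcHighF, arcHighT, (handle i i.2).2.2.1, (handle i i.2).1, (handle i i.2).2.2.2,
    (handle i i.2).2.1]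

/-- A predicate that is invariant along the boundaries of the 2-cells holds everywhere if it
holds on `cellReps`. -/
theorem forall_of_cellReps (P : LadderDart m h → Prop)
    (hn : ∀ x s, P (x, s) ↔ P (rotInv (x, !s))) (hB : ∀ d ∈ cellReps m h, P d) (d) : P d := by
  have upT (k) : P (edge (up k), true) := hB _ (Or.inl ⟨k, rfl⟩)
  have arcHighT : P (arcHigh, true) := hB _ (Or.inr rfl)
  have downT (k) : P (edge (down k), true) := (hn (edge (up k)) true).1 (upT k)
  have longF (k : ℕ) (hk : k < m + 1) : P (edge (long ⟨k, hk⟩), false) := by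
    induction k with
    | zero => exact (hn _ _).2 arcHighT
    | succ k ih => exact (hn _ _).2 (ih (by omega))
  have arcHighF : P (arcHigh, false) := (hn _ _).2 (longF _ _)
  have loopF : P (edge loop, false) := (hn _ _).2 arcHighF
  have downF (k) : P (edge (down k), false) := by
    rw [hn]
    simp only [Bool.not_false, rotInv]
    split_ifs
    exacts [upT _, loopF]
  have upF (k) : P (edge (up k), false) := (hn _ _).2 (downF k)
  -- The left side of the long cycle is followed forwards until `up 0`, so the induction is on the
  -- distance t to the last edge; the right side above runs backwards to `arcHigh`.
  have longT (t k : ℕ) (hk : k + t = m) : P (edge (long ⟨k, by omega⟩), true) := by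
    induction t generalizing k with
    | zero =>
      rw [hn]
      simp only [Bool.not_true, rotInv]
      rw [dif_neg (by omega)]
      exact upT _
    | succ t ih =>
      rw [hn]
      simp only [Bool.not_true, rotInv]
      rw [dif_pos (by omega)]
      exact ih (k + 1) (by omega)
  have arcLowF : P (arcLow, false) := (hn _ _).2 (longT m 0 (by omega))
  have loopT : P (edge loop, true) := (hn _ _).2 arcLowF
  have arcLowT : P (arcLow, true) := (hn _ _).2 loopT
  -- Each handle occurs on the boundary of 2-cell 0 as a commutator: `longitude` reversed,
  -- `meridian`, `longitude`, `meridian` reversed, then the preceding handle or `arcLow`.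
  have step (i) (h1 : P (meridian i, false)) : P (meridian i, true) ∧ P (longitude i, true) ∧
      P (meridian i, false) ∧ P (longitude i, false) := by
    have h2 : P (longitude i, true) := (hn _ _).2 h1
    have h3 : P (meridian i, true) := (hn _ _).2 h2
    exact ⟨h3, h2, h1, (hn _ _).2 h3⟩
  have handle (i : ℕ) (hh : i < h) :
      P (meridian ⟨i, hh⟩, true) ∧ P (longitude ⟨i, hh⟩, true) ∧
        P (meridian ⟨i, hh⟩, false) ∧ P (longitude ⟨i, hh⟩, false) := by
    induction i with
    | zero => exact step _ ((hn _ _).2 arcLowT)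
    | succ i ih => exact step _ ((hn _ _).2 (ih (by omega)).2.2.2)
  rcases d with ⟨(((k | k | k | _) | _ | _ | i | i)), (_ | _)⟩
  exacts [upF k, upT k, downF k, downT k, longF k k.2, longT (m - k) k (by omega), loopF, loopT,
    arcLowF, arcLowT, arcHighF, arcHighT, (handle i i.2).2.2.1, (handle i i.2).1,
    (handle i i.2).2.2.2, (handle i i.2).2.1]

/-- The label is constant under rotation, every dart can be rotated to a representative, and
representatives have distinct labels. Questions about vertices become arithmetic. -/
theorem sameCycle_rot {d d' : LadderDart m h} :
    (rot m h).SameCycle d d' ↔ vertexLabel d = vertexLabel d' := by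
  refine Equiv.Perm.sameCycle_iff_of_reps vertexLabel_rot (B := vertexReps m h) ?_ ?_
  · refine forall_of_vertexReps _ ?_ ?_ fun d hd => ⟨d, hd, .refl _ _⟩
    · rintro d ⟨x, hx, hdx⟩
      exact ⟨x, hx, (Equiv.Perm.sameCycle_apply_left (f := rot m h)).1 hdx⟩
    · rintro d ⟨x, hx, hdx⟩
      refine ⟨x, hx, ?_⟩
      rw [← Equiv.Perm.sameCycle_apply_left (f := rot m h)] at hdx
      rwa [← rotFun_rotInv d]
  · rintro d hd d' hd' hdd
    rcases hd with ⟨k, rfl⟩ | rfl | ⟨k, hk, rfl⟩ <;>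
      rcases hd' with ⟨k', rfl⟩ | rfl | ⟨k', hk', rfl⟩ <;>
      simp only [vertexLabel] at hdd <;> grind

theorem sameCycle_next {d d' : LadderDart m h} :
    ((rot m h)⁻¹ * rev m h).SameCycle d d' ↔ cellLabel d = cellLabel d' := by
  refine Equiv.Perm.sameCycle_iff_of_reps cellLabel_next (B := cellReps m h) ?_ ?_
  · refine forall_of_cellReps _ ?_ fun d hd => ⟨d, hd, .refl _ _⟩
    intro x s
    refine exists_congr fun y => and_congr_right fun _ => ?_
    exact (Equiv.Perm.sameCycle_apply_left (f := (rot m h)⁻¹ * rev m h)).symm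
  · rintro d hd d' hd' hdd
    rcases hd with ⟨k, rfl⟩ | rfl <;> rcases hd' with ⟨k', rfl⟩ | rfl <;>
      simp only [cellLabel] at hdd <;> grind

theorem sameCycle_rev {d d' : LadderDart m h} : (rev m h).SameCycle d d' ↔ d.1 = d'.1 := by
  refine Equiv.Perm.sameCycle_iff_of_reps (f := Prod.fst) (fun _ => rfl)
    (B := {d | d.2 = true}) ?_ ?_
  · rintro ⟨x, _ | _⟩
    · exact ⟨(x, true), rfl, (Equiv.Perm.sameCycle_apply_left (f := rev m h)).1 (.refl _ _)⟩
    · exact ⟨_, rfl, .refl _ _⟩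
  · rintro ⟨x, s⟩ hs ⟨y, t⟩ ht hxy
    exact Prod.ext hxy (hs.trans ht.symm)

theorem range_vertexLabel :
    Set.range (vertexLabel : LadderDart m h → ℕ) = Set.Iio (2 * (m + 1)) := by
  refine Set.Subset.antisymm ?_ fun i hi => ?_
  · rintro _ ⟨⟨(((k | k | k | _) | _ | _ | i | i)), (_ | _)⟩, rfl⟩ <;>
      simp only [vertexLabel, Set.mem_Iio] <;> grind
  · rw [Set.mem_Iio] at hi
    rcases lt_trichotomy i (m + 1) with hi' | rfl | hi'
    · exact ⟨(edge (up ⟨i, hi'⟩), true), rfl⟩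
    · exact ⟨(edge loop, true), rfl⟩
    · refine ⟨(edge (long ⟨i - (m + 1), by omega⟩), true), ?_⟩
      simp only [vertexLabel]
      grind

theorem range_cellLabel : Set.range (cellLabel : LadderDart m h → ℕ) = Set.Iio (m + 2) := by
  refine Set.Subset.antisymm ?_ fun i hi => ?_
  · rintro _ ⟨⟨(((k | k | k | _) | _ | _ | i | i)), (_ | _)⟩, rfl⟩ <;>
      simp only [cellLabel, Set.mem_Iio] <;> grind
  · rcases Nat.lt_succ_iff_lt_or_eq.1 hi with hi' | rfl
    · exact ⟨(edge (up ⟨i, hi'⟩), true), rfl⟩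
    · exact ⟨(edge loop, false), rfl⟩

/-- Rotation moves within a vertex, so it is enough to reach each vertex from `up 0`: reversal
climbs the ladder and runs along the long cycle. -/
theorem isPretransitive (m h : ℕ) :
    MulAction.IsPretransitive (Subgroup.closure {rot m h, rev m h}) (LadderDart m h) := by
  let H := Subgroup.closure {rot m h, rev m h}
  have hrot : rot m h ∈ H := Subgroup.subset_closure (by simp)
  have hrev : rev m h ∈ H := Subgroup.subset_closure (by simp)
  let P (d : LadderDart m h) : Prop := d ∈ MulAction.orbit H ((edge (up 0), true) : LadderDart m h)
  have hP (σ : Equiv.Perm (LadderDart m h)) (hσ : σ ∈ H) (d) (hd : P (σ d)) : P d := by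
    obtain ⟨τ, hτ⟩ := hd
    exact ⟨⟨σ, hσ⟩⁻¹ * τ, by simpa [mul_smul, inv_smul_eq_iff] using hτ⟩
  have hf (d) (hd : P (rotFun d)) : P d := hP _ hrot d hd
  have hi (d) (hd : P (rotInv d)) : P d := hP _ (H.inv_mem hrot) d hd
  have hr (x s) (hd : P (x, !s)) : P (x, s) := hP _ hrev (x, s) hd
  have up' (k : ℕ) (hk : k < m + 1) : P (edge (up ⟨k, hk⟩), true) := by
    induction k with
    | zero => exact MulAction.mem_orbit_self _
    -- Two rotations take `up (k + 1)` through `down k` to the reverse of `up k`.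
    | succ k ih => exact hf _ (hf (edge (down ⟨k, by omega⟩), true) (hr _ _ (ih (by omega))))
  have arcHighT : P (arcHigh, true) := by
    refine hi _ (hi (edge (long (Fin.last m)), false) ?_)
    simp only [rotInv]
    rw [dif_neg (by simp)]
    exact up' 0 _
  have long' (k : ℕ) (hk : k < m + 1) : P (edge (long ⟨k, hk⟩), true) := by
    induction k with
    | zero => exact hi _ arcHighT
    | succ k ih => exact hf _ (hr _ _ (ih (by omega)))
  have all : ∀ d, P d := by
    refine forall_of_vertexReps P hf hi ?_
    rintro d (⟨k, rfl⟩ | rfl | ⟨k, -, rfl⟩)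
    exacts [up' k k.2, hi _ (hr _ _ arcHighT), long' k k.2]
  exact (MulAction.isPretransitive_iff_base _).2 all

/-- The surface of genus `h + 2`, with `b` holes in the 2-cell on the right of the loop. -/
noncomputable def surface (m h b : ℕ) : CellSurface (LadderDart m h) where
  rot := rot m h
  rev := rev m h
  rev_rev d := by simp [rev]
  rev_ne d := by simp [rev, Prod.ext_iff]
  nonempty := ⟨(arcLow, true)⟩
  connected := isPretransitive m h
  -- This is 2-cell m + 1, where `numbering` vanishes, so the same walk is bounding for every b.
  holes := open Classical in fun c => if c = Quotient.mk _ (edge loop, false) then b else 0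

theorem card_vertices (m h b : ℕ) : Nat.card (surface m h b).Vertex = 2 * (m + 1) := by
  refine (Equiv.Perm.card_quotient_sameCycle fun _ _ => sameCycle_rot).trans ?_
  simp [range_vertexLabel]

theorem card_cells (m h b : ℕ) : Nat.card (surface m h b).Cell = m + 2 := by
  refine (Equiv.Perm.card_quotient_sameCycle fun _ _ => sameCycle_next).trans ?_
  simp [range_cellLabel]

theorem card_edges (m h b : ℕ) :
    Nat.card (surface m h b).Edge = 3 * (m + 1) + 3 + 2 * h := by
  refine (Equiv.Perm.card_quotient_sameCycle fun _ _ => sameCycle_rev).trans ?_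
  rw [Set.range_eq_univ.2 fun x => ⟨(x, true), rfl⟩, Nat.card_univ, Nat.card_eq_fintype_card,
    SkeletonEdge.card]

/-- The Euler characteristic is 2(m + 1) - (3(m + 1) + 3 + 2h) + (m + 2) = -2 - 2h: each additional
handle costs two edges and changes neither the vertices nor the 2-cells in number. -/
theorem hasGenus_surface (m h b : ℕ) : (surface m h b).HasGenus (h + 2) := by
  rw [CellSurface.HasGenus, card_vertices, card_edges, card_cells]
  push_cast
  ring

theorem boundaryComponents_surface (m h b : ℕ) : (surface m h b).boundaryComponents = b := by
  unfold CellSurface.boundaryComponents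
  rw [finsum_eq_single _ ((surface m h b).leftCell (edge loop, false))]
  · exact if_pos rfl
  · intro c hc
    exact if_neg hc

end LadderDart

/-! ### Directed walks -/

namespace DirectedMultigraph

variable {V E : Type*} {G : DirectedMultigraph V E}

theorem IsWalk.append {u v x : V} {w w' : List E} (hw : G.IsWalk u w v) (hw' : G.IsWalk v w' x) :
    G.IsWalk u (w ++ w') x := by
  induction w generalizing u with
  | nil => exact (show u = v from hw) ▸ hw'
  | cons e w ih => exact ⟨hw.1, ih hw.2⟩

theorem IsWalk.flatten_replicate {u : V} {w : List E} (hw : G.IsWalk u w u) (N : ℕ) :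
    G.IsWalk u (List.replicate N w).flatten u := by
  induction N with
  | zero => rfl
  | succ N ih => exact hw.append ih

theorem isWalk_ofFn {N : ℕ} (p : ℕ → V) (f : Fin N → E) (ht : ∀ i, G.tail (f i) = p i)
    (hh : ∀ i, G.head (f i) = p (i + 1)) : G.IsWalk (p 0) (List.ofFn f) (p N) := by
  induction N generalizing p with
  | zero => rfl
  | succ N ih =>
    rw [List.ofFn_succ]
    refine ⟨ht 0, ?_⟩
    rw [hh 0]
    exact ih (fun i => p (i + 1)) _ (fun i => ht i.succ) fun i => hh i.succ

/-- A walk that uses only edges with both or no ends in `s` stays in `s` or outside `s`. -/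
theorem IsWalk.tail_mem_iff {s : Set V} {u v : V} {w : List E} (hw : G.IsWalk u w v)
    (hs : ∀ e ∈ w, G.tail e ∈ s ↔ G.head e ∈ s) : ∀ e ∈ w, G.tail e ∈ s ↔ u ∈ s := by
  induction w generalizing u with
  | nil => simp
  | cons e w ih =>
    obtain ⟨rfl, hw⟩ := hw
    intro e' he'
    rcases List.mem_cons.1 he' with rfl | he'
    · rfl
    · rw [ih hw (fun e he => hs e (List.mem_cons_of_mem _ he)) e' he', hs e List.mem_cons_self]

end DirectedMultigraph

theorem List.count_ofFn_of_injective {E : Type*} [DecidableEq E] {N : ℕ} {f : Fin N → E}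
    (hf : Function.Injective f) (i : Fin N) : (List.ofFn f).count (f i) = 1 :=
  List.count_eq_one_of_mem (List.nodup_ofFn.2 hf) (List.mem_ofFn.2 ⟨i, rfl⟩)

/-! ### The embedded graph and the absence of trivial edges -/

namespace LadderDart

open LadderEdge SkeletonEdge

variable {m h b : ℕ}

instance : Nonempty (SkeletonEdge m h) := ⟨arcLow⟩

theorem vertexOf_eq_iff {d d' : LadderDart m h} :
    (surface m h b).vertexOf d = (surface m h b).vertexOf d' ↔ vertexLabel d = vertexLabel d' :=
  Quotient.eq.trans sameCycle_rot

theorem leftCell_eq_iff {d d' : LadderDart m h} :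
    (surface m h b).leftCell d = (surface m h b).leftCell d' ↔ cellLabel d = cellLabel d' :=
  Quotient.eq.trans sameCycle_next

theorem edgeOf_eq_iff {d d' : LadderDart m h} :
    (surface m h b).edgeOf d = (surface m h b).edgeOf d' ↔ d.1 = d'.1 :=
  Quotient.eq.trans sameCycle_rev

/-- The vertex with a given number. -/
noncomputable def vertex (m h b : ℕ) (i : ℕ) : (surface m h b).Vertex :=
  (surface m h b).vertexOf (Function.invFun vertexLabel i)

theorem vertexOf_eq_vertex (d : LadderDart m h) :
    (surface m h b).vertexOf d = vertex m h b (vertexLabel d) :=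
  vertexOf_eq_iff.2 (Function.invFun_eq ⟨d, rfl⟩).symm

/-- The graph, on the vertices of the cell structure. -/
noncomputable def graph (m h b : ℕ) : DirectedMultigraph (surface m h b).Vertex (LadderEdge m) where
  tail e := (surface m h b).vertexOf (edge e, true)
  head e := (surface m h b).vertexOf (edge e, false)

/-- The embedding of the graph. -/
noncomputable def embedding (m h b : ℕ) : SurfaceEmbedding (graph m h b) (surface m h b) where
  vertex := id
  vertex_injective := Function.injective_id
  dart e := (edge e, true)
  edge_injective e e' hee := by simpa using edgeOf_eq_iff.1 hee
  vertexOf_dart _ := rfl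
  vertexOf_rev_dart _ := rfl

/-- A set of 2-cells, as a predicate on their numbers. -/
theorem exists_label_predicate (R : Set (surface m h b).Cell) :
    ∃ Q : ℕ → Prop, ∀ x, (surface m h b).edgeOf (x, true) ∈ (surface m h b).frontierEdges R ↔
      ¬ (Q (cellLabel (x, true)) ↔ Q (cellLabel (x, false))) := by
  let g (d : LadderDart m h) : Prop := (surface m h b).leftCell d ∈ R
  have hg : g.FactorsThrough cellLabel := fun d d' hd => by
    simp only [g, leftCell_eq_iff.2 hd]
  -- The default `False` only concerns numbers that label no 2-cell.
  refine ⟨Function.extend cellLabel g fun _ => False, fun x => ?_⟩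
  rw [hg.extend_apply, hg.extend_apply]
  have hd (P : LadderDart m h → Prop) :
      (∃ d, (surface m h b).edgeOf d = (surface m h b).edgeOf (x, true) ∧ P d) ↔
        P (x, true) ∨ P (x, false) := by
    constructor
    · rintro ⟨⟨y, s⟩, hy, hP⟩
      obtain rfl : y = x := edgeOf_eq_iff.1 hy
      cases s
      exacts [.inr hP, .inl hP]
    · rintro (hP | hP)
      exacts [⟨_, rfl, hP⟩, ⟨(x, false), edgeOf_eq_iff.2 rfl, hP⟩]
  refine (and_congr (hd _) (hd _)).trans ?_
  simp only [g]
  tauto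

/-- A set of edges that contains the long cycle or the loop only is not a frontier. -/
theorem not_boundsDisk_of_up_notMem {X : Set (surface m h b).Edge}
    (hup : ∀ k, (surface m h b).edgeOf (edge (up k), true) ∉ X)
    {e : LadderEdge m} (he : (surface m h b).edgeOf (edge e, true) ∈ X)
    (hdown : ∀ k, e ≠ down k) : ¬ (surface m h b).BoundsDisk X := by
  rintro ⟨R, rfl, -, -⟩
  obtain ⟨Q, hQ⟩ := exists_label_predicate R
  -- Neighbouring 2-cells share `up k`, which is off the frontier. Hence 0 and m + 1, the two sides
  -- of every long edge and of the loop, lie both in R or both outside.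
  have step (k : ℕ) (hk : k < m + 1) : Q k ↔ Q (k + 1) :=
    not_not.1 (mt (hQ (edge (up ⟨k, hk⟩))).2 (hup ⟨k, hk⟩))
  have all (k : ℕ) (hk : k ≤ m + 1) : Q 0 ↔ Q k := by
    induction k with
    | zero => rfl
    | succ k ih => exact (ih (by omega)).trans (step k (by omega))
  cases e with
  | up k => exact hup k he
  | down k => exact hdown k rfl
  | long k => exact (hQ _).1 he (all _ le_rfl)
  | loop => exact (hQ _).1 he (all _ le_rfl)

/-- A two-edge cycle of the ladder is not a frontier. -/
theorem not_boundsDisk_pair (k : Fin (m + 1)) :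
    ¬ (surface m h b).BoundsDisk {(surface m h b).edgeOf (edge (up k), true),
      (surface m h b).edgeOf (edge (down k), true)} := by
  rintro ⟨R, hR, -, -⟩
  obtain ⟨Q, hQ⟩ := exists_label_predicate R
  rw [hR] at hQ
  have step (j : ℕ) (hj : j < m + 1) (hjk : j ≠ k) : Q j ↔ Q (j + 1) :=
    not_not.1 (mt (hQ (edge (up ⟨j, hj⟩))).2 (by simp [edgeOf_eq_iff, Fin.ext_iff, hjk]))
  -- The loop closes the chain of 2-cells to a cycle. With only link k removed, the rest of the
  -- cycle still joins k to k + 1.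
  have ends : Q 0 ↔ Q (m + 1) :=
    not_not.1 (mt (hQ (edge loop)).2 (by simp [edgeOf_eq_iff]))
  have below (j : ℕ) (hj : j ≤ k) : Q 0 ↔ Q j := by
    induction j with
    | zero => rfl
    | succ j ih => exact (ih (by omega)).trans (step j (by omega) (by omega))
  have above (j : ℕ) (hj : k + 1 + j ≤ m + 1) : Q (k + 1) ↔ Q (k + 1 + j) := by
    induction j with
    | zero => rfl
    | succ j ih => exact (ih (by omega)).trans (step _ (by omega) (by omega))
  refine (hQ (edge (up k))).1 (.inl rfl) ((below k le_rfl).symm.trans (ends.trans ?_))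
  have := above (m - k) (by omega)
  rw [show k.1 + 1 + (m - k) = m + 1 by omega] at this
  exact this.symm

theorem noTrivialEdges (m h b : ℕ) : (embedding m h b).NoTrivialEdges := by
  constructor
  · intro e he
    replace he : vertexLabel _ = vertexLabel _ := vertexOf_eq_iff.1 he
    refine not_boundsDisk_of_up_notMem (e := e) (fun k hk => ?_) rfl ?_
    · obtain rfl : e = up k := by simpa [embedding] using (edgeOf_eq_iff.1 hk).symm
      simp [vertexLabel] at he
    · rintro k rfl
      simp [vertexLabel] at he
  · intro e e' hee hends
    have hends : (vertexLabel (h := h) (edge e, true) = vertexLabel (h := h) (edge e', true) ∧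
        vertexLabel (h := h) (edge e, false) = vertexLabel (h := h) (edge e', false)) ∨
        (vertexLabel (h := h) (edge e, true) = vertexLabel (h := h) (edge e', false) ∧
        vertexLabel (h := h) (edge e, false) = vertexLabel (h := h) (edge e', true)) :=
      hends.imp (And.imp vertexOf_eq_iff.1 vertexOf_eq_iff.1)
        (And.imp vertexOf_eq_iff.1 vertexOf_eq_iff.1)
    -- Besides the two edges of a rung, distinct edges share both endpoints only on the long cycle,
    -- when it has length two.
    have key : (∃ k, (e = up k ∧ e' = down k) ∨ (e = down k ∧ e' = up k)) ∨
        ∀ k, e ≠ up k ∧ e' ≠ up k ∧ e ≠ down k := by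
      have hext (k k' : Fin (m + 1)) (hk : k.1 = k'.1) : k = k' := Fin.ext hk
      cases e <;> cases e' <;> simp only [vertexLabel] at hends <;> grind
    rcases key with ⟨k, ⟨rfl, rfl⟩ | ⟨rfl, rfl⟩⟩ | key
    · exact not_boundsDisk_pair k
    · rw [Set.pair_comm]
      exact not_boundsDisk_pair k
    · refine not_boundsDisk_of_up_notMem (e := e) (fun k hk => ?_) (.inl rfl) fun k => (key k).2.2
      rcases hk with hk | hk
      · exact (key k).1 (by simpa [embedding] using (edgeOf_eq_iff.1 hk).symm)
      · exact (key k).2.1 (by simpa [embedding] using (edgeOf_eq_iff.1 hk).symm)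

/-! ### A bounding closed walk -/

/-- The Alexander numbering that decreases by one from each 2-cell to the next. -/
noncomputable def numbering (m h b : ℕ) : (embedding m h b).Face → ℤ :=
  Quot.lift (Quotient.lift (fun d => (m + 1 - cellLabel d : ℤ))
    fun d d' hd => by rw [sameCycle_next.1 hd]) (by
      rintro _ _ ⟨⟨x, s⟩, hd, rfl, rfl⟩
      -- Off the graph there are only arcs and handle loops, with one 2-cell on both sides.
      have hx : cellLabel (x, s) = cellLabel (x, !s) := by
        cases x with
        | edge e => exact (hd e (edgeOf_eq_iff.2 rfl)).elim
        | _ => rfl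
      exact congrArg (fun i : ℕ => (m + 1 - i : ℤ)) hx)

theorem isAlexanderNumbering_numbering :
    (embedding m h b).IsAlexanderNumbering (numbering m h b) := by
  rintro _ ⟨c, rfl, hc⟩
  have hc : c = (surface m h b).leftCell (edge loop, false) := by
    by_contra hne
    exact hc (if_neg hne)
  subst hc
  change ((m : ℤ) + 1 - (m + 1 : ℕ)) = 0
  simp

theorem boundary_numbering (e : LadderEdge m) :
    (embedding m h b).boundary (numbering m h b) e =
      cellLabel (h := h) (edge e, false) - cellLabel (h := h) (edge e, true) := by
  change ((m : ℤ) + 1 - cellLabel (h := h) (edge e, true)) -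
    (m + 1 - cellLabel (h := h) (edge e, false)) = _
  ring

/-- A closed walk once up and down the ladder, and `m + 1` times along the long cycle and the
loop. -/
def tour (m : ℕ) : List (LadderEdge m) :=
  (List.replicate (m + 1) (List.ofFn long)).flatten ++
    (List.ofFn up ++ ((List.replicate (m + 1) [loop]).flatten ++ List.ofFn fun k => down k.rev))

theorem isClosedWalk_tour : (graph m h b).IsClosedWalk (tour m) := by
  refine ⟨by simp [tour], vertex m h b 0, ?_⟩
  have hlong : (graph m h b).IsWalk (vertex m h b 0) (List.ofFn long) (vertex m h b 0) := by
    have := DirectedMultigraph.isWalk_ofFn (G := graph m h b)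
      -- The long cycle starts and ends at vertex 0; its inner vertices are numbered from m + 2.
      (fun i => vertex m h b (if i = 0 ∨ i = m + 1 then 0 else m + 1 + i))
      (fun k : Fin (m + 1) => long k)
      (fun k => (vertexOf_eq_vertex _).trans (congrArg _ (by simp only [vertexLabel]; grind)))
      (fun k => (vertexOf_eq_vertex _).trans (congrArg _ (by simp only [vertexLabel]; grind)))
    simpa using this
  have hup : (graph m h b).IsWalk (vertex m h b 0) (List.ofFn up) (vertex m h b (m + 1)) :=
    DirectedMultigraph.isWalk_ofFn (vertex m h b) _ (fun k => vertexOf_eq_vertex _)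
      (fun k => vertexOf_eq_vertex _)
  have hdown : (graph m h b).IsWalk (vertex m h b (m + 1))
      (List.ofFn fun k : Fin (m + 1) => down k.rev) (vertex m h b 0) := by
    have := DirectedMultigraph.isWalk_ofFn (G := graph m h b)
      (fun i => vertex m h b (m + 1 - i))
      (fun k : Fin (m + 1) => down k.rev)
      (fun k => (vertexOf_eq_vertex _).trans
        (congrArg _ (by simp only [vertexLabel, Fin.val_rev]; omega)))
      (fun k => (vertexOf_eq_vertex _).trans
        (congrArg _ (by simp only [vertexLabel, Fin.val_rev])))
    simpa using this
  have hloop : (graph m h b).IsWalk (vertex m h b (m + 1)) [loop] (vertex m h b (m + 1)) :=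
    ⟨vertexOf_eq_vertex _, vertexOf_eq_vertex _⟩
  exact (hlong.flatten_replicate _).append
    (hup.append ((hloop.flatten_replicate _).append hdown))

/-- The numbering drops by 1 across each ladder edge and by m + 1 across the loop and the long
edges, which are the multiplicities in `tour`. -/
theorem isBounding_tour : (embedding m h b).IsBounding (tour m) := by
  refine ⟨isClosedWalk_tour, numbering m h b, isAlexanderNumbering_numbering, fun e => ?_⟩
  rw [boundary_numbering]
  have hl := List.count_ofFn_of_injective (f := long (m := m)) fun k k' hk => by simpa using hk
  have hu := List.count_ofFn_of_injective (f := up (m := m)) fun k k' hk => by simpa using hk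
  have hd (k : Fin (m + 1)) : (List.ofFn fun k : Fin (m + 1) => down k.rev).count (down k) = 1 := by
    have := List.count_ofFn_of_injective (f := fun k : Fin (m + 1) => down k.rev)
      (fun k k' hk => by simpa using hk) k.rev
    simpa using this
  have h0 {f : Fin (m + 1) → LadderEdge m} {e} (hf : ∀ k, f k ≠ e) : (List.ofFn f).count e = 0 :=
    List.count_eq_zero.2 fun he => by
      obtain ⟨k, hk⟩ := List.mem_ofFn.1 he
      exact hf k hk
  cases e <;> simp [-List.ofFn_succ, tour, List.count_flatten, List.count_replicate, cellLabel, hl, hu, hd, h0]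

/-! ### The quadratic lower bound -/

/-- A bounding closed walk must use the whole ladder, hence the long cycle `m + 1` times. -/
theorem sq_le_length_of_isBounding {w : List (LadderEdge m)}
    (hw : (embedding m h b).IsBounding w) : (m + 1) ^ 2 ≤ w.length := by
  obtain ⟨⟨hne, v, hwalk⟩, α, -, hα⟩ := hw
  let f (d : LadderDart m h) : ℤ := α ((embedding m h b).faceOf ((surface m h b).leftCell d))
  have hf : f.FactorsThrough cellLabel := fun d d' hd => by
    simp only [f, leftCell_eq_iff.2 hd]
  obtain ⟨A, hA⟩ : ∃ A : ℕ → ℤ, ∀ d, f d = A (cellLabel d) :=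
    ⟨Function.extend cellLabel f 0, fun d => (hf.extend_apply _ _).symm⟩
  have hcount (e) : (w.count e : ℤ) =
      A (cellLabel (h := h) (edge e, true)) - A (cellLabel (h := h) (edge e, false)) :=
    (hα e).trans (congrArg₂ _ (hA _) (hA _))
  have hup (k) : (w.count (up k) : ℤ) = A k - A (k + 1) := hcount _
  have hdown (k) : (w.count (down k) : ℤ) = A k - A (k + 1) := hcount _
  have hlong (k) : (w.count (long k) : ℤ) = A 0 - A (m + 1) := hcount _
  have hloop : (w.count loop : ℤ) = A 0 - A (m + 1) := hcount _
  have step (k : ℕ) (hk : k < m + 1) : A (k + 1) ≤ A k := by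
    have := hup ⟨k, hk⟩
    simp only at this
    omega
  have anti (i j : ℕ) (hj : i + j ≤ m + 1) : A (i + j) ≤ A i := by
    induction j with
    | zero => rfl
    | succ j ih => exact (step (i + j) (by omega)).trans (ih (by omega))
  -- A is nonincreasing. If its total drop were zero, every drop and so every edge count would
  -- vanish, but the walk has an edge.
  have hpos : 0 < A 0 - A (m + 1) := by
    by_contra hN
    have flat (k : Fin (m + 1)) : A k - A (k + 1) ≤ 0 := by
      have h1 := anti 0 k (by omega)
      have h2 := anti (k + 1) (m - k) (by omega)
      rw [show k.1 + 1 + (m - k) = m + 1 by omega] at h2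
      rw [zero_add] at h1
      omega
    obtain ⟨e, he⟩ := List.exists_mem_of_ne_nil w hne
    have := List.count_pos_iff.2 he
    cases e with
    | up k => have := hup k; have := flat k; omega
    | down k => have := hdown k; have := flat k; omega
    | long k => have := hlong k; omega
    | loop => omega
  -- If A did not drop at k, the walk would avoid both edges of rung k, the only edges between the
  -- upper part of the ladder and the rest. Yet it uses both `long 0` and `loop`.
  have strict (k : ℕ) (hk : k < m + 1) : A (k + 1) + 1 ≤ A k := by
    by_contra hlt
    have hu := hup ⟨k, hk⟩
    have hd := hdown ⟨k, hk⟩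
    simp only at hu hd
    have hu : up ⟨k, hk⟩ ∉ w := List.count_eq_zero.1 (by omega)
    have hd : down ⟨k, hk⟩ ∉ w := List.count_eq_zero.1 (by omega)
    let g : (surface m h b).Vertex → ℕ :=
      Quotient.lift vertexLabel fun d d' hd => sameCycle_rot.1 hd
    -- The bound m + 1 excludes the inner vertices of the long cycle, whose numbers are larger.
    have side := hwalk.tail_mem_iff (s := {x | k < g x ∧ g x ≤ m + 1}) (fun e he => by
      change (k < vertexLabel (h := h) (edge e, true) ∧
          vertexLabel (h := h) (edge e, true) ≤ m + 1) ↔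
        (k < vertexLabel (h := h) (edge e, false) ∧
          vertexLabel (h := h) (edge e, false) ≤ m + 1)
      cases e <;> simp only [vertexLabel] <;> grind)
    have h0 := side (long 0) (List.count_pos_iff.1 (by have := hlong 0; omega))
    have h1 := side loop (List.count_pos_iff.1 (by omega))
    have h0' : ¬ (k < 0 ∧ 0 ≤ m + 1) := by omega
    have h1' : k < m + 1 ∧ m + 1 ≤ m + 1 := ⟨hk, le_rfl⟩
    exact h0' (h0.2 (h1.1 h1'))
  have drop (i : ℕ) (hi : i ≤ m + 1) : A i + i ≤ A 0 := by
    induction i with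
    | zero => simp
    | succ i ih =>
      have := ih (by omega)
      have := strict i (by omega)
      push_cast
      omega
  have hm := drop (m + 1) le_rfl
  have hge (k) : m + 1 ≤ w.count (long k) := by
    have := hlong k
    omega
  calc (m + 1) ^ 2 = ∑ k : Fin (m + 1), (m + 1) := by simp [sq]
    _ ≤ ∑ k : Fin (m + 1), w.count (long k) := Finset.sum_le_sum fun k _ => hge k
    _ = ∑ e ∈ Finset.univ.map ⟨long, fun k k' hk => by simpa using hk⟩, w.count e := by
      rw [Finset.sum_map]
      rfl
    _ ≤ ∑ e, w.count e := Finset.sum_le_sum_of_subset (Finset.subset_univ _)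
    _ = w.length := by
      simpa using Multiset.sum_count_eq_card (s := Finset.univ) (m := (w : Multiset (LadderEdge m))) (by simp)

end LadderDart

/-! ### The theorem -/

theorem mainTheorem8 (g : ℕ) (hg : 2 ≤ g) :
    ∃ c : ℝ, 0 < c ∧ ∀ b n : ℕ, 1 ≤ n →
      ∃ (V E D : Type) (_ : Fintype V) (_ : Fintype E) (_ : DecidableEq E) (_ : Fintype D)
        (G : DirectedMultigraph V E) (S : CellSurface D) (φ : SurfaceEmbedding G S),
        Fintype.card V = 2 * n ∧ Fintype.card E = 3 * n + 1 ∧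
        S.HasGenus g ∧ S.boundaryComponents = b ∧ φ.NoTrivialEdges ∧
        ∃ l : ℕ, φ.IsShortestBoundingLength l ∧ c * (n : ℝ) ^ 2 ≤ (l : ℝ) := by
  obtain ⟨h, rfl⟩ := Nat.exists_eq_add_of_le' hg
  -- The bound n² holds exactly, so c = 1 serves for every genus.
  refine ⟨1, one_pos, fun b n hn => ?_⟩
  obtain ⟨m, rfl⟩ := Nat.exists_eq_add_of_le' hn
  have hfin : Finite (LadderDart.surface m h b).Vertex := Quotient.finite _
  have := Fintype.ofFinite (LadderDart.surface m h b).Vertex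
  obtain ⟨l, hl⟩ : ∃ l, (LadderDart.embedding m h b).IsShortestBoundingLength l := by
    have hne : {k | ∃ w, (LadderDart.embedding m h b).IsBounding w ∧ w.length = k}.Nonempty :=
      ⟨_, _, LadderDart.isBounding_tour, rfl⟩
    exact ⟨sInf _, Nat.sInf_mem hne, fun k hk => Nat.sInf_le hk⟩
  refine ⟨_, _, _, ‹_›, inferInstance, inferInstance, inferInstance, LadderDart.graph m h b,
    LadderDart.surface m h b, LadderDart.embedding m h b, ?_, LadderEdge.card m,
    LadderDart.hasGenus_surface m h b, LadderDart.boundaryComponents_surface m h b,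
    LadderDart.noTrivialEdges m h b, l, hl, ?_⟩
  · rw [← Nat.card_eq_fintype_card, LadderDart.card_vertices]
  · obtain ⟨w, hw, rfl⟩ := hl.1
    rw [one_mul]
    exact_mod_cast LadderDart.sq_le_length_of_isBounding hw
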